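/- \textbf{Setting.} Let $G=(V,E)$ be a finite simple graph, with one qubit for each vertex, and let $|G\rangle=\prod_{\{a,b\}\in E}CZ_{ab}\,|+\rangle^{\otimes V}$ be its graph state. Let $n_o\ge 1$ and $\hat\kappa_b\ge 2$ be integers, and let $V=V_o\sqcup V_c$, where $V_o=\{o_1,\dots,o_{n_o}\}$ is linearly ordered (the \emph{orchestration} qubits) and $V_c$ is the set of the other vertices (the \emph{peer} qubits). A \emph{bridge} is a peer with exactly two neighbours in $V_o$. Suppose that $(G,\hat\kappa_b)$ is \emph{Generalized Tree-like} (GTL), with peer degree $\kappa_c=2\hat\kappa_b$, that is: \begin{itemize} \item no edge of $G$ lies inside $V_o$ or inside $V_c$; \item every $o_i$ has exactly $2\hat\kappa_b$ neighbours in $V_c$; \item every bridge is adjacent to both members of exactly one consecutive pair $(o_j,o_{j+1})$; \item every consecutive pair $(o_j,o_{j+1})$ shares exactly $\hat\kappa_b$ bridges. \end{itemize} \textbf{Corollary (Maximal Parallel Bell-Pair Instantiation).} \begin{enumerate} \item There are $\hat\kappa_b+n_o(\hat\kappa_b-2)$ distinct peers and, among the remaining peers, $n_o$ pairwise disjoint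 pairs of qubits such that the following holds. Measure Pauli $X$ on all $n_o$ orchestration qubits of $|G\rangle$, and then Pauli $Z$ on the chosen peers. Every sequence of outcomes has positive probability, and for every sequence of outcomes the resulting state is, up to single-qubit unitaries, the tensor product of a Bell state $(|00\rangle+|11\rangle)/\sqrt2$ on each of the $n_o$ pairs and of some state of the other qubits. \item The Schmidt measure of $|G\rangle$ equals $n_o$. Here the Schmidt measure of a pure state is $\log_2 r$, where $r$ is the least number of product vectors (every qubit being a party of its own) of which the state is a linear combination. \item The number $n_o$ is the maximum possible: it is the largest $k$ for which some finite LOCC protocol, with every qubit a party of its own, turns $|G\rangle$ with certainty into $k$ disjoint Bell pairs (tensored with some state of the other qubits). Moreover, no LOCC protocol obtains more than $n_o$ disjoint Bell pairs from $|G\rangle$ with positive probability. \end{enumerate} -/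

import Mathlib

namespace GTLState

noncomputable section

/-! ## Qubit registers, local operators, Pauli measurements -/

/-- (Not necessarily normalised) pure states of one qubit per element of `V`, given by their
amplitudes in the computational basis. -/
abbrev QState (V : Type*) := (V → Fin 2) → ℂ

/-- Single-qubit operators, as matrices in the computational basis. -/
abbrev QubitOp := Matrix (Fin 2) (Fin 2) ℂ

/-- The Pauli operator `X`. -/
def pauliX : QubitOp := !![0, 1; 1, 0]

/-- The Pauli operator `Z`. -/
def pauliZ : QubitOp := !![1, 0; 0, -1]

/-- The projector `(1 + (-1)^s P) / 2` onto the `(-1)^s`-eigenspace of a Pauli operator `P`;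
`s = 0` is the outcome `+`, and `s = 1` is the outcome `-`. -/
def pauliProj (P : QubitOp) (s : Fin 2) : QubitOp :=
  (1 / 2 : ℂ) • (1 + (-1 : ℂ) ^ (s : ℕ) • P)

/-- The operator `A` acting on qubit `v`, and the identity on all other qubits. -/
def applyAt {V : Type*} [DecidableEq V] (v : V) (A : QubitOp) (ψ : QState V) : QState V :=
  fun x => ∑ b : Fin 2, A (x v) b * ψ (Function.update x v b)

/-- The product operator `⨂ v, A v`. -/
def applyProd {V : Type*} [Fintype V] [DecidableEq V] (A : V → QubitOp) (ψ : QState V) :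
    QState V :=
  fun x => ∑ y : V → Fin 2, (∏ v, A v (x v) (y v)) * ψ y

/-- The unnormalised state after measuring the Pauli operator `P` successively on the listed
qubits, with the listed outcomes. Its squared norm is the probability of these outcomes. -/
def measurePauli {V : Type*} [DecidableEq V] (P : QubitOp) :
    List (V × Fin 2) → QState V → QState V
  | [], ψ => ψ
  | (v, s) :: l, ψ => measurePauli P l (applyAt v (pauliProj P s) ψ)

/-! ## Graph states -/

/-- The diagonal entry at the basis vector `x` of the controlled-`Z` gate on the two ends of
the edge `e`. -/
def czPhase {V : Type*} (x : V → Fin 2) (e : Sym2 V) : ℂ :=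
  Sym2.lift ⟨fun a b => if x a = 1 ∧ x b = 1 then -1 else 1, fun a b => by
    simp only [and_comm]⟩ e

/-- The graph state of `G`: a controlled-`Z` gate for every edge of `G`, applied to the state in
which every qubit is `(|0⟩ + |1⟩) / √2`. -/
def graphState {V : Type*} [Fintype V] [DecidableEq V] (G : SimpleGraph V)
    [DecidableRel G.Adj] : QState V :=
  fun x => (∏ e ∈ G.edgeFinset, czPhase x e) * ∏ _v : V, ((1 / Real.sqrt 2 : ℝ) : ℂ)

/-! ## Generalized Tree-like graphs -/

section Graph

variable {V : Type*} [Fintype V] [DecidableEq V]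

/-- The set of orchestration vertices `o₁, …, oₙ`. -/
def orch {n : ℕ} (o : Fin n ↪ V) : Finset V := Finset.univ.map o

/-- The set of peer vertices. -/
def peers {n : ℕ} (o : Fin n ↪ V) : Finset V := (orch o)ᶜ

/-- The bridges of rank `r`: the peer vertices with exactly `r` orchestration neighbours. -/
def bridges (G : SimpleGraph V) [DecidableRel G.Adj] {n : ℕ} (o : Fin n ↪ V) (r : ℕ) :
    Finset V :=
  (peers o).filter fun b => (G.neighborFinset b ∩ orch o).card = r

/-- `G`, with the linearly ordered orchestration vertices `o 0, o 1, …`, and with all other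
vertices as peers, is a Generalized Tree-like graph of peer degree `κc` whose consecutive
orchestration vertices share `κb` bridges. -/
structure IsGTL (G : SimpleGraph V) [DecidableRel G.Adj] {n : ℕ} (o : Fin n ↪ V)
    (κc κb : ℕ) : Prop where
  κb_pos : 0 < κb
  two_mul_κb_le : 2 * κb ≤ κc
  /-- two-colorability: no edge joins two orchestration vertices -/
  orch_indep : ∀ a ∈ orch o, ∀ b ∈ orch o, ¬ G.Adj a b
  /-- two-colorability: no edge joins two peers -/
  peers_indep : ∀ a ∈ peers o, ∀ b ∈ peers o, ¬ G.Adj a b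
  /-- peer degree regularity -/
  peer_degree : ∀ i, (G.neighborFinset (o i) ∩ peers o).card = κc
  /-- linear bridge ordering: a bridge is adjacent to exactly one consecutive pair -/
  bridge_linear : ∀ b ∈ bridges G o 2,
    ∃! p : Fin n × Fin n, (p.1 : ℕ) + 1 = p.2 ∧ G.Adj b (o p.1) ∧ G.Adj b (o p.2)
  /-- bridge regularity: a consecutive pair shares exactly `κb` bridges -/
  bridge_regular : ∀ i j : Fin n, (i : ℕ) + 1 = j →
    ((bridges G o 2).filter fun b => G.Adj b (o i) ∧ G.Adj b (o j)).card = κb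

end Graph

/-! ## Schmidt measure -/

/-- The least number of product vectors of which `ψ` is a linear combination, where every qubit
is a party of its own. -/
def schmidtRank {V : Type*} [Fintype V] (ψ : QState V) : ℕ :=
  sInf {r : ℕ | ∃ (ξ : Fin r → ℂ) (f : Fin r → V → Fin 2 → ℂ),
    ∀ x, ψ x = ∑ i, ξ i * ∏ v, f i v (x v)}

/-- The Schmidt measure of a pure state. -/
def schmidtMeasure {V : Type*} [Fintype V] (ψ : QState V) : ℝ :=
  Real.logb 2 (schmidtRank ψ)

/-! ## Bell pairs and LOCC protocols -/

/-- The amplitudes of the Bell state `(|00⟩ + |11⟩) / √2`. -/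
def bellAmp (a b : Fin 2) : ℂ := if a = b then ((1 / Real.sqrt 2 : ℝ) : ℂ) else 0

/-- `ψ` is the tensor product of a Bell state on the qubits `e (i, 0)` and `e (i, 1)`, for every
`i`, and of some vector on the other qubits. The pairs are disjoint, as `e` is injective. -/
def BellPairsOn {V : Type*} {k : ℕ} (e : Fin k × Fin 2 ↪ V) (ψ : QState V) : Prop :=
  ∃ rest : ({v : V // v ∉ Set.range e} → Fin 2) → ℂ, ∀ x : V → Fin 2,
    ψ x = (∏ i, bellAmp (x (e (i, 0))) (x (e (i, 1)))) * rest fun v => x v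

/-- A finite LOCC protocol in which every qubit is a party of its own. In each round, some qubit
`v` undergoes a local quantum instrument with Kraus operators `K`, the outcome is broadcast, and
the rest of the protocol may depend on it. Local unitaries are the instruments with one
outcome. -/
inductive LOCC (V : Type*) where
  | finish : LOCC V
  | round (v : V) (m : ℕ) (K : Fin m → QubitOp) (hK : ∑ i, (K i).conjTranspose * K i = 1)
      (next : Fin m → LOCC V) : LOCC V

/-- The unnormalised final states of the branches of an LOCC protocol started in `ψ`; the squared
norm is the probability of the branch. -/
def LOCC.branches {V : Type*} [DecidableEq V] : LOCC V → QState V → Set (QState V)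
  | .finish, ψ => {ψ}
  | .round v _ K _ next, ψ => ⋃ i, (next i).branches (applyAt v (K i) ψ)

/-- The protocol `p` turns `ψ` with certainty into `k` disjoint Bell pairs (on qubits that may
depend on the measurement outcomes). -/
def LOCC.Extracts {V : Type*} [DecidableEq V] (p : LOCC V) (ψ : QState V) (k : ℕ) : Prop :=
  ∀ φ ∈ p.branches ψ, φ ≠ 0 → ∃ e : Fin k × Fin 2 ↪ V, BellPairsOn e φ

end

end GTLState

/-!
The orchestration qubits and the peers form the two sides of a bipartite graph, so the amplitude of
the graph state at `x` is, up to a constant, `∏ i, (-1) ^ (x (o i) * P i x)`, where `P i x` is the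
parity of the bits of `x` at the neighbours of `o i` (`IsGTL.graphState_eq`). Flipping the qubit
`o i` multiplies this amplitude by `(-1) ^ P i x`. Hence an `X` measurement of `o i` with outcome
`s i` keeps exactly the configurations with `P i x = s i`, and a `Z` measurement fixes a bit
(`IsGTL.measured_eq`).

The bridge conditions force the neighbours of the orchestration vertices into a chain of `n + 1`
groups of `κb` peers each: a vertex adjacent to two orchestration vertices is a bridge between
consecutive ones (`IsGTL.mem_bridges_of_adj`). As `κb ≥ 2`, there is for each `k` a pair of peers
adjacent to exactly `o (k - 1)` and `o k`, or to `o 0` only if `k = 0` (`IsGTL.exists_pairs`).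
Once all other neighbours, `κb + n * (κb - 2)` in number, are measured in `Z`
(`IsGTL.exists_rest`), the `i`-th parity constraint prescribes the sum of the parities of the
pairs `i` and `i + 1`. This system is triangular (`pairParity_injective`), so it fixes the parity of
every pair; after flipping one qubit of each odd pair, every pair is in a Bell state
(`IsGTL.exists_correction`).

The upper bounds rest on the number of product vectors needed to span a state. A local operator
does not increase it (`HasProductRank.of_mem_branches`), `2 ^ n` of them suffice for the graph
state (`IsGTL.hasProductRank`), and a state with `k` Bell pairs needs at least `2 ^ k`
(`HasProductRank.two_pow_le`), since across the cut that separates the two members of each pair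
the amplitudes contain a multiple of an identity matrix of that size. So no branch of a protocol has
more than `n` Bell pairs. Conversely, the measurements above are a protocol that yields `n` Bell
pairs, and for the same reason the graph state is not a combination of fewer than `2 ^ n` product
vectors.
-/

namespace GTLState

/-! ### Signs, bit flips and Pauli measurements -/

/-- The character `a ↦ (-1)^a` of the group of bits. -/
def bitSign (a : Fin 2) : ℂ := (-1) ^ (a : ℕ)

lemma bitSign_zero : bitSign 0 = 1 := by simp [bitSign]

lemma bitSign_ne_zero (a : Fin 2) : bitSign a ≠ 0 := by simp [bitSign]

lemma bitSign_add (a b : Fin 2) : bitSign (a + b) = bitSign a * bitSign b := by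
  fin_cases a <;> fin_cases b <;> simp [bitSign]

lemma bitSign_sum {ι : Type*} (s : Finset ι) (f : ι → Fin 2) :
    bitSign (∑ i ∈ s, f i) = ∏ i ∈ s, bitSign (f i) := by
  classical
  induction s using Finset.induction_on with
  | empty => simp [bitSign_zero]
  | insert a s ha ih => rw [Finset.sum_insert ha, Finset.prod_insert ha, bitSign_add, ih]

lemma bit_add_self (a : Fin 2) : a + a = 0 := by
  fin_cases a <;> rfl

lemma bit_add_eq_zero {a b : Fin 2} : a + b = 0 ↔ a = b := by
  fin_cases a <;> fin_cases b <;> simp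

/-- The operator `X ^ c`. -/
def bitFlip (c : Fin 2) : QubitOp := fun a b => if b = a + c then 1 else 0

lemma bitFlip_conjTranspose_mul_self (c : Fin 2) : (bitFlip c).conjTranspose * bitFlip c = 1 := by
  ext a b
  fin_cases c <;> fin_cases a <;> fin_cases b <;>
    simp [Matrix.mul_apply, bitFlip]

lemma bitFlip_mem_unitaryGroup (c : Fin 2) : bitFlip c ∈ Matrix.unitaryGroup (Fin 2) ℂ := by
  rw [Matrix.mem_unitaryGroup_iff']
  exact bitFlip_conjTranspose_mul_self c

lemma sum_pauliProj_pauliX :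
    ∑ s : Fin 2, (pauliProj pauliX s).conjTranspose * pauliProj pauliX s = 1 := by
  have h2 : (starRingEnd ℂ) 2 = 2 := Complex.conj_ofNat 2
  ext a b
  fin_cases a <;> fin_cases b <;>
    simp [Fin.sum_univ_two, Matrix.mul_apply, pauliProj, pauliX, h2] <;> norm_num

lemma sum_pauliProj_pauliZ :
    ∑ s : Fin 2, (pauliProj pauliZ s).conjTranspose * pauliProj pauliZ s = 1 := by
  have h2 : (starRingEnd ℂ) 2 = 2 := Complex.conj_ofNat 2
  ext a b
  fin_cases a <;> fin_cases b <;>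
    simp [Fin.sum_univ_two, Matrix.mul_apply, pauliProj, pauliZ, h2] <;> norm_num

section LocalOperators

variable {V : Type*} [DecidableEq V]

lemma update_eq_add_single (x : V → Fin 2) (v : V) (c : Fin 2) :
    Function.update x v (x v + c) = x + Pi.single v c := by
  ext w
  by_cases h : w = v
  · subst h; simp
  · simp [h]

lemma applyAt_bitFlip (v : V) (c : Fin 2) (ψ : QState V) :
    applyAt v (bitFlip c) ψ = fun x => ψ (x + Pi.single v c) := by
  ext x
  simp only [applyAt, bitFlip, ite_mul, one_mul, zero_mul]
  rw [Finset.sum_ite_eq' Finset.univ (x v + c), if_pos (Finset.mem_univ _),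
    update_eq_add_single]

lemma applyProd_bitFlip [Fintype V] (c : V → Fin 2) (ψ : QState V) :
    applyProd (fun v => bitFlip (c v)) ψ = fun x => ψ (x + c) := by
  ext x
  have h : ∀ y : V → Fin 2, (∏ v, bitFlip (c v) (x v) (y v)) = if y = x + c then 1 else 0 := by
    intro y
    simp only [bitFlip]
    rw [Fintype.prod_ite_zero]
    simp [funext_iff]
  simp [applyProd, h]

lemma applyAt_pauliProj_pauliZ (v : V) (t : Fin 2) (ψ : QState V) :
    applyAt v (pauliProj pauliZ t) ψ = fun x => if x v = t then ψ x else 0 := by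
  ext x
  have hx : Function.update x v (x v) = x := Function.update_eq_self v x
  rcases Fin.exists_fin_two.mp ⟨x v, rfl⟩ with h | h <;> rw [h] at hx <;> fin_cases t <;>
    simp [applyAt, pauliProj, pauliZ, Fin.sum_univ_two, h, hx] <;> ring

lemma applyAt_pauliProj_pauliX (v : V) (s : Fin 2) (ψ : QState V) :
    applyAt v (pauliProj pauliX s) ψ =
      fun x => (1 / 2) * (ψ x + bitSign s * ψ (x + Pi.single v 1)) := by
  ext x
  have hx : Function.update x v (x v) = x := Function.update_eq_self v x
  rw [← update_eq_add_single]
  rcases Fin.exists_fin_two.mp ⟨x v, rfl⟩ with h | h <;> rw [h] at hx <;>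
    simp [applyAt, pauliProj, pauliX, Fin.sum_univ_two, h, hx, bitSign] <;> ring

/-- If flipping the qubit `v` multiplies the amplitude at `x` by `(-1)^(g x)`, then measuring `X`
on `v` keeps exactly the amplitudes at which `g` is the outcome. -/
lemma applyAt_pauliProj_pauliX_of_flip (v : V) (s : Fin 2) (ψ : QState V)
    (g : (V → Fin 2) → Fin 2) (h : ∀ x, ψ (x + Pi.single v 1) = bitSign (g x) * ψ x) :
    applyAt v (pauliProj pauliX s) ψ = fun x => if g x = s then ψ x else 0 := by
  rw [applyAt_pauliProj_pauliX]
  ext x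
  rw [h]
  generalize g x = a
  fin_cases a <;> fin_cases s <;> simp [bitSign] <;> ring

lemma measurePauli_pauliZ (l : List (V × Fin 2)) (ψ : QState V) :
    measurePauli pauliZ l ψ = fun x => if ∀ p ∈ l, x p.1 = p.2 then ψ x else 0 := by
  induction l generalizing ψ with
  | nil => simp [measurePauli]
  | cons p l ih =>
    obtain ⟨v, t⟩ := p
    rw [measurePauli, ih, applyAt_pauliProj_pauliZ]
    ext x
    simp only [List.forall_mem_cons]
    split_ifs <;> tauto

/-- Successive `X` measurements of qubits whose flips act on `ψ` by the signs `(-1)^(g v x)`, with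
`g v x` unaffected by these flips, project onto the configurations `x` at which every `g v x`
is the outcome at `v`. -/
lemma measurePauli_pauliX (l : List (V × Fin 2)) (ψ : QState V) (g : V → (V → Fin 2) → Fin 2)
    (h : ∀ p ∈ l, ∀ x, ψ (x + Pi.single p.1 1) = bitSign (g p.1 x) * ψ x)
    (hg : ∀ p ∈ l, ∀ q ∈ l, ∀ x, g p.1 (x + Pi.single q.1 1) = g p.1 x) :
    measurePauli pauliX l ψ = fun x => if ∀ p ∈ l, g p.1 x = p.2 then ψ x else 0 := by
  induction l generalizing ψ with
  | nil => simp [measurePauli]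
  | cons p l ih =>
    obtain ⟨v, s⟩ := p
    rw [measurePauli, applyAt_pauliProj_pauliX_of_flip v s ψ (g v) (h (v, s) (by simp)), ih]
    · ext x
      simp only [List.forall_mem_cons]
      split_ifs <;> tauto
    · intro p hp x
      have h1 := hg (v, s) (by simp) p (by simp [hp]) x
      have h2 := h p (by simp [hp]) x
      simp only at h1
      rw [h1, h2]
      simp
    · intro p hp q hq
      exact hg p (by simp [hp]) q (by simp [hq])

end LocalOperators

/-! ### Decompositions into product vectors -/

/-- `ψ` is a tensor product of one-qubit vectors. -/
def IsProductVector {V : Type*} [Fintype V] (ψ : QState V) : Prop :=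
  ∃ f : V → Fin 2 → ℂ, ∀ x, ψ x = ∏ v, f v (x v)

/-- `ψ` is a linear combination of `r` product vectors. -/
def HasProductRank {V : Type*} [Fintype V] (ψ : QState V) (r : ℕ) : Prop :=
  ∃ (ξ : Fin r → ℂ) (f : Fin r → V → Fin 2 → ℂ), ∀ x, ψ x = ∑ i, ξ i * ∏ v, f i v (x v)

section ProductRank

variable {V : Type*} [Fintype V]

lemma IsProductVector.single [DecidableEq V] (w : V) (h : Fin 2 → ℂ) :
    IsProductVector fun x : V → Fin 2 => h (x w) := by
  refine ⟨fun v b => if v = w then h b else 1, fun x => ?_⟩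
  simp

lemma IsProductVector.prod {ι : Type*} (s : Finset ι) (ψ : ι → QState V)
    (h : ∀ i ∈ s, IsProductVector (ψ i)) : IsProductVector fun x => ∏ i ∈ s, ψ i x := by
  choose! f hf using h
  refine ⟨fun v b => ∏ i ∈ s, f i v b, fun x => ?_⟩
  rw [Finset.prod_comm]
  exact Finset.prod_congr rfl fun i hi => hf i hi x

lemma HasProductRank.of_sum {ι : Type*} [Fintype ι] {ψ : QState V} (c : ℂ) (φ : ι → QState V)
    (h : ∀ i, IsProductVector (φ i)) (hψ : ∀ x, ψ x = ∑ i, c * φ i x) :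
    HasProductRank ψ (Fintype.card ι) := by
  choose f hf using h
  let ε := Fintype.equivFin ι
  refine ⟨fun _ => c, fun j => f (ε.symm j), fun x => ?_⟩
  rw [hψ, ← ε.symm.sum_comp]
  simp [hf]

/-- A local operator maps product vectors to product vectors. -/
lemma HasProductRank.applyAt [DecidableEq V] {ψ : QState V} {r : ℕ} (h : HasProductRank ψ r)
    (v : V) (A : QubitOp) : HasProductRank (applyAt v A ψ) r := by
  obtain ⟨ξ, f, hf⟩ := h
  refine ⟨ξ, fun i => Function.update (f i) v fun a => ∑ b, A a b * f i v b, fun x => ?_⟩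
  have key : ∀ (i : Fin r) (b : Fin 2), ∏ w, f i w (Function.update x v b w) =
      f i v b * ∏ w ∈ Finset.univ.erase v, f i w (x w) := by
    intro i b
    rw [← Finset.mul_prod_erase _ _ (Finset.mem_univ v)]
    congr 1
    · simp
    · exact Finset.prod_congr rfl fun w hw => by
        rw [Function.update_of_ne (Finset.ne_of_mem_erase hw)]
  have key' : ∀ i : Fin r, ∏ w, Function.update (f i) v (fun a => ∑ b, A a b * f i v b) w (x w) =
      (∑ b, A (x v) b * f i v b) * ∏ w ∈ Finset.univ.erase v, f i w (x w) := by
    intro i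
    rw [← Finset.mul_prod_erase _ _ (Finset.mem_univ v)]
    congr 1
    · simp
    · exact Finset.prod_congr rfl fun w hw => by
        rw [Function.update_of_ne (Finset.ne_of_mem_erase hw)]
  simp only [GTLState.applyAt, hf, key, key', Finset.mul_sum, Finset.sum_mul]
  rw [Finset.sum_comm]
  exact Finset.sum_congr rfl fun i _ => Finset.sum_congr rfl fun b _ => by ring

lemma HasProductRank.of_mem_branches [DecidableEq V] {r : ℕ} (p : LOCC V) {ψ φ : QState V}
    (h : HasProductRank ψ r) (hφ : φ ∈ p.branches ψ) : HasProductRank φ r := by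
  induction p generalizing ψ with
  | finish =>
    rw [LOCC.branches, Set.mem_singleton_iff] at hφ
    exact hφ ▸ h
  | round v m K hK next ih =>
    rw [LOCC.branches, Set.mem_iUnion] at hφ
    obtain ⟨i, hi⟩ := hφ
    exact ih i (h.applyAt v (K i)) hi

lemma prod_bellAmp {k : ℕ} (a b : Fin k → Fin 2) :
    ∏ i, bellAmp (a i) (b i) = if a = b then ((1 / Real.sqrt 2 : ℝ) : ℂ) ^ k else 0 := by
  simp only [bellAmp]
  rw [Fintype.prod_ite_zero]
  simp [funext_iff]

/-- Fix the qubits outside the pairs at a configuration with nonzero amplitude. With respect to the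
cut between the first and the second members of the pairs, the amplitudes then form a nonzero
multiple of the identity matrix of size `2 ^ k`, whereas every product vector contributes a matrix
of rank at most one. -/
lemma HasProductRank.two_pow_le {k r : ℕ} {ψ : QState V} (h : HasProductRank ψ r)
    (e : Fin k × Fin 2 ↪ V) (hB : BellPairsOn e ψ) (h0 : ψ ≠ 0) : 2 ^ k ≤ r := by
  classical
  obtain ⟨ξ, f, hf⟩ := h
  obtain ⟨rest, hrest⟩ := hB
  obtain ⟨x₀, hx₀⟩ := Function.ne_iff.mp h0
  set c : ℂ := rest fun v => x₀ v with hc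
  have hc0 : c ≠ 0 := by
    intro h
    apply hx₀
    rw [hrest x₀, ← hc, h]
    simp
  let conf : (Fin k → Fin 2) → (Fin k → Fin 2) → V → Fin 2 := fun a b =>
    Function.extend e (fun p => if p.2 = 0 then a p.1 else b p.1) x₀
  have conf_fst : ∀ a b i, conf a b (e (i, 0)) = a i := fun a b i => by
    simp [conf, e.injective.extend_apply]
  have conf_snd : ∀ a b i, conf a b (e (i, 1)) = b i := fun a b i => by
    simp [conf, e.injective.extend_apply]
  have conf_off : ∀ a b v, v ∉ Set.range e → conf a b v = x₀ v := fun a b v hv => by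
    simp only [conf]
    exact Function.extend_apply' _ _ _ hv
  set d : ℂ := ((1 / Real.sqrt 2 : ℝ) : ℂ) ^ k * c with hd
  have hd0 : d ≠ 0 := by
    refine mul_ne_zero (pow_ne_zero _ ?_) hc0
    rw [Complex.ofReal_ne_zero]
    positivity
  have hconf : ∀ a b, ψ (conf a b) = if a = b then d else 0 := by
    intro a b
    rw [hrest]
    have : (fun v : {v : V // v ∉ Set.range e} => conf a b v) =
        fun v : {v : V // v ∉ Set.range e} => x₀ v := by
      ext v
      rw [conf_off a b v v.2]
    rw [this, ← hc]
    simp only [conf_fst, conf_snd]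
    rw [prod_bellAmp, ite_mul, zero_mul]
  let P : Matrix (Fin k → Fin 2) (Fin r) ℂ := fun a j => ∏ i, f j (e (i, 0)) (a i)
  let Q : Matrix (Fin r) (Fin k → Fin 2) ℂ := fun j b =>
    d⁻¹ * ξ j * (∏ i, f j (e (i, 1)) (b i)) * ∏ v ∈ (Finset.univ.map e)ᶜ, f j v (x₀ v)
  have hsplit : ∀ j a b, ∏ v, f j v (conf a b v) =
      (∏ i, f j (e (i, 0)) (a i)) * (∏ i, f j (e (i, 1)) (b i)) *
        ∏ v ∈ (Finset.univ.map e)ᶜ, f j v (x₀ v) := by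
    intro j a b
    rw [← Finset.prod_mul_prod_compl (Finset.univ.map e)]
    congr 1
    · rw [Finset.prod_map, Fintype.prod_prod_type, ← Finset.prod_mul_distrib]
      simp only [Fin.prod_univ_two, conf_fst, conf_snd]
    · refine Finset.prod_congr rfl fun v hv => ?_
      rw [conf_off]
      simpa using hv
  have hPQ : P * Q = 1 := by
    ext a b
    have h1 : d⁻¹ * ψ (conf a b) = (P * Q) a b := by
      rw [hf, Matrix.mul_apply, Finset.mul_sum]
      refine Finset.sum_congr rfl fun j _ => ?_
      rw [hsplit]
      simp only [P, Q]
      ring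
    rw [← h1, hconf, Matrix.one_apply, mul_ite, mul_zero, inv_mul_cancel₀ hd0]
  have h1 := (Matrix.rank_mul_le_left P Q).trans (Matrix.rank_le_card_width P)
  rw [hPQ, Matrix.rank_one] at h1
  simpa using h1

end ProductRank

/-! ### Protocols -/

section Protocols

variable {V : Type*} [DecidableEq V]

lemma sum_applyAt_applyAt {m : ℕ} (v : V) (K L : Fin m → QubitOp) (ψ : QState V) (x : V → Fin 2) :
    ∑ i, applyAt v (L i) (applyAt v (K i) ψ) x = applyAt v (∑ i, L i * K i) ψ x := by
  simp only [applyAt, Function.update_self, Function.update_idem, Matrix.sum_apply,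
    Matrix.mul_apply, Fin.sum_univ_two, Finset.sum_mul, ← Finset.sum_add_distrib]
  exact Finset.sum_congr rfl fun i _ => by ring

lemma applyAt_one (v : V) (ψ : QState V) : applyAt v 1 ψ = ψ := by
  ext x
  simp [applyAt, Matrix.one_apply]

/-- Some outcome of every protocol has positive probability. -/
lemma LOCC.exists_branch_ne_zero (p : LOCC V) {ψ : QState V} (hψ : ψ ≠ 0) :
    ∃ φ ∈ p.branches ψ, φ ≠ 0 := by
  induction p generalizing ψ with
  | finish => exact ⟨ψ, by simp [LOCC.branches], hψ⟩
  | round v m K hK next ih =>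
    obtain ⟨i, hi⟩ : ∃ i, applyAt v (K i) ψ ≠ 0 := by
      by_contra! h
      apply hψ
      ext x
      have h1 := sum_applyAt_applyAt v K (fun i => (K i).conjTranspose) ψ x
      rw [hK, applyAt_one] at h1
      rw [← h1]
      exact Finset.sum_eq_zero fun i _ => by rw [h i]; simp [applyAt]
    obtain ⟨φ, hφ, hφ0⟩ := ih i hi
    exact ⟨φ, by rw [LOCC.branches]; exact Set.mem_iUnion.mpr ⟨i, hφ⟩, hφ0⟩

/-- Measuring a Pauli operator on a sequence of qubits, and going on according to the outcomes, is
an LOCC protocol. -/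
lemma LOCC.exists_measurePauli (P : QubitOp)
    (hP : ∑ s : Fin 2, (pauliProj P s).conjTranspose * pauliProj P s = 1) {n : ℕ} (v : Fin n → V)
    (next : (Fin n → Fin 2) → LOCC V) :
    ∃ p : LOCC V, ∀ ψ, ∀ φ ∈ p.branches ψ, ∃ s : Fin n → Fin 2,
      φ ∈ (next s).branches (measurePauli P (List.ofFn fun i => (v i, s i)) ψ) := by
  induction n with
  | zero => exact ⟨next Fin.elim0, fun ψ φ hφ => ⟨Fin.elim0, by simpa [measurePauli] using hφ⟩⟩
  | succ n ih =>
    choose q hq using fun s₀ : Fin 2 =>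
      ih (fun i => v i.succ) fun s => next (Fin.cons s₀ s)
    refine ⟨.round (v 0) 2 (pauliProj P) hP q, fun ψ φ hφ => ?_⟩
    rw [LOCC.branches, Set.mem_iUnion] at hφ
    obtain ⟨s₀, hφ⟩ := hφ
    obtain ⟨s, hs⟩ := hq s₀ _ φ hφ
    exact ⟨Fin.cons s₀ s, by simpa [List.ofFn_succ, measurePauli] using hs⟩

/-- Flipping any set of qubits is an LOCC protocol with a single branch. -/
lemma LOCC.exists_bitFlip [Fintype V] (c : V → Fin 2) :
    ∃ p : LOCC V, ∀ ψ, p.branches ψ = {fun x => ψ (x + c)} := by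
  have key : ∀ l : List V, ∃ p : LOCC V, ∀ ψ,
      p.branches ψ = {fun x => ψ (x + (l.map fun v => Pi.single v (c v)).sum)} := by
    intro l
    induction l with
    | nil => exact ⟨.finish, fun ψ => by simp [LOCC.branches]⟩
    | cons v l ih =>
      obtain ⟨p, hp⟩ := ih
      refine ⟨.round v 1 (fun _ => bitFlip (c v)) (by simp [bitFlip_conjTranspose_mul_self])
        fun _ => p, fun ψ => ?_⟩
      simp only [LOCC.branches, hp, applyAt_bitFlip, Set.iUnion_const, List.map_cons,
        List.sum_cons]
      congr 1
      ext x
      congr 1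
      abel
  obtain ⟨p, hp⟩ := key Finset.univ.toList
  refine ⟨p, fun ψ => ?_⟩
  rw [hp, Finset.sum_map_toList, Finset.univ_sum_single]

end Protocols

/-! ### The bridge structure -/

lemma mem_orch {V : Type*} {n : ℕ} {o : Fin n ↪ V} {v : V} : v ∈ orch o ↔ ∃ i, o i = v := by
  simp [orch]

section Graph

variable {V : Type*} [Fintype V] [DecidableEq V] {G : SimpleGraph V} [DecidableRel G.Adj]
  {n : ℕ} {o : Fin n ↪ V} {κc κb : ℕ}

lemma mem_peers {v : V} : v ∈ peers o ↔ ∀ i, o i ≠ v := by simp [peers, mem_orch]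

lemma IsGTL.mem_peers_of_adj (hG : IsGTL G o κc κb) {v : V} {i : Fin n} (h : G.Adj v (o i)) :
    v ∈ peers o := by
  by_contra hv
  exact hG.orch_indep v (by simpa [peers] using hv) (o i) (mem_orch.mpr ⟨i, rfl⟩) h

lemma IsGTL.card_neighborFinset (hG : IsGTL G o κc κb) (i : Fin n) :
    (G.neighborFinset (o i)).card = κc := by
  rw [← hG.peer_degree i]
  congr 1
  ext v
  simp only [Finset.mem_inter, SimpleGraph.mem_neighborFinset, iff_self_and]
  exact fun h => hG.mem_peers_of_adj h.symm

lemma card_neighborFinset_inter_orch (b : V) :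
    (G.neighborFinset b ∩ orch o).card =
      (Finset.univ.filter fun i => G.Adj b (o i)).card := by
  rw [← Finset.card_map o]
  congr 1
  ext v
  simp only [Finset.mem_inter, SimpleGraph.mem_neighborFinset, mem_orch, Finset.mem_map,
    Finset.mem_filter, Finset.mem_univ, true_and]
  constructor
  · rintro ⟨h, i, rfl⟩
    exact ⟨i, h, rfl⟩
  · rintro ⟨i, h, rfl⟩
    exact ⟨h, i, rfl⟩

lemma IsGTL.mem_bridges_two (hG : IsGTL G o κc κb) {b : V} {i : Fin n} (h : G.Adj b (o i)) :
    b ∈ bridges G o 2 ↔ (Finset.univ.filter fun i => G.Adj b (o i)).card = 2 := by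
  rw [bridges, Finset.mem_filter, card_neighborFinset_inter_orch]
  simp [hG.mem_peers_of_adj h]

/-- The bridges to both sides of an inner orchestration vertex already exhaust its `2 * κb`
neighbours. -/
lemma IsGTL.mem_bridges_of_inner (hG : IsGTL G o (2 * κb) κb) {i k j : Fin n}
    (hik : (i : ℕ) + 1 = k) (hkj : (k : ℕ) + 1 = j) {b : V} (h : G.Adj b (o k)) :
    b ∈ bridges G o 2 := by
  set A := (bridges G o 2).filter fun b => G.Adj b (o i) ∧ G.Adj b (o k) with hA
  set B := (bridges G o 2).filter fun b => G.Adj b (o k) ∧ G.Adj b (o j) with hB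
  have hdisj : Disjoint A B := by
    rw [Finset.disjoint_left]
    intro v hvA hvB
    rw [hA, Finset.mem_filter] at hvA
    rw [hB, Finset.mem_filter] at hvB
    have h1 := (hG.bridge_linear v hvA.1).unique (y₁ := (i, k)) (y₂ := (k, j)) ⟨hik, hvA.2⟩
      ⟨hkj, hvB.2⟩
    have h2 : i = k := congrArg Prod.fst h1
    subst h2
    omega
  have hcard : (A ∪ B).card = 2 * κb := by
    rw [Finset.card_union_of_disjoint hdisj, hA, hB, hG.bridge_regular i k hik,
      hG.bridge_regular k j hkj]
    ring
  have hsub : A ∪ B ⊆ G.neighborFinset (o k) := by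
    intro v hv
    rw [SimpleGraph.mem_neighborFinset]
    rcases Finset.mem_union.mp hv with hv | hv
    · exact (Finset.mem_filter.mp hv).2.2.symm
    · exact (Finset.mem_filter.mp hv).2.1.symm
  have heq := Finset.eq_of_subset_of_card_le hsub (by rw [hcard, hG.card_neighborFinset])
  have hb : b ∈ A ∪ B := by
    rw [heq, SimpleGraph.mem_neighborFinset]
    exact h.symm
  rcases Finset.mem_union.mp hb with hb | hb <;> exact (Finset.mem_filter.mp hb).1

/-- A vertex with two orchestration neighbours has no third one, as the middle one of three would
be an inner orchestration vertex. -/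
lemma IsGTL.mem_bridges_of_adj (hG : IsGTL G o (2 * κb) κb) {i j : Fin n} (hij : i < j) {b : V}
    (hi : G.Adj b (o i)) (hj : G.Adj b (o j)) : (i : ℕ) + 1 = j ∧ b ∈ bridges G o 2 := by
  set I := Finset.univ.filter fun i => G.Adj b (o i) with hI
  have mem_I : ∀ {i}, i ∈ I ↔ G.Adj b (o i) := by simp [hI]
  have hb : b ∈ bridges G o 2 := by
    have h3 : ∀ i ∈ I, ∀ k ∈ I, ∀ j ∈ I, i < k → k < j → b ∈ bridges G o 2 := by
      intro i _ k hk j _ hik hkj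
      have hk0 : (k : ℕ) - 1 < n := by omega
      have hk1 : (k : ℕ) + 1 < n := by omega
      have hpos : 0 < (k : ℕ) := by omega
      exact hG.mem_bridges_of_inner (i := ⟨k - 1, hk0⟩) (j := ⟨k + 1, hk1⟩)
        (by simp only; omega) rfl (mem_I.mp hk)
    have h1 : 1 < I.card :=
      Finset.one_lt_card.mpr ⟨i, mem_I.mpr hi, j, mem_I.mpr hj, hij.ne⟩
    by_cases h2 : I.card = 2
    · exact (hG.mem_bridges_two hi).mpr h2
    · obtain ⟨x, hx, y, hy, z, hz, hxy, hxz, hyz⟩ := Finset.two_lt_card.mp (by omega : 2 < I.card)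
      rcases lt_or_gt_of_ne hxy with a | a <;> rcases lt_or_gt_of_ne hxz with b' | b' <;>
        rcases lt_or_gt_of_ne hyz with c | c
      · exact h3 x hx y hy z hz a c
      · exact h3 x hx z hz y hy b' c
      · exact absurd (a.trans c) (not_lt.mpr b'.le)
      · exact h3 z hz x hx y hy b' a
      · exact h3 y hy x hx z hz a b'
      · exact absurd (b'.trans c) (not_lt.mpr a.le)
      · exact h3 y hy z hz x hx c b'
      · exact h3 z hz y hy x hx c a
  refine ⟨?_, hb⟩
  have h2 : I.card = 2 := (hG.mem_bridges_two hi).mp hb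
  obtain ⟨p, ⟨hp, hp1, hp2⟩, -⟩ := hG.bridge_linear b hb
  have hIeq : ({i, j} : Finset (Fin n)) = I :=
    Finset.eq_of_subset_of_card_le
      (by intro x; simp only [Finset.mem_insert, Finset.mem_singleton]
          rintro (rfl | rfl)
          · exact mem_I.mpr hi
          · exact mem_I.mpr hj)
      (by rw [h2, Finset.card_pair hij.ne])
  have e1 := mem_I.mpr hp1
  have e2 := mem_I.mpr hp2
  rw [← hIeq, Finset.mem_insert, Finset.mem_singleton] at e1 e2
  rcases e1 with e1 | e1 <;> rcases e2 with e2 | e2 <;> rw [e1, e2] at hp <;> omega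

lemma IsGTL.card_common (hG : IsGTL G o (2 * κb) κb) {i j : Fin n} (hij : (i : ℕ) + 1 = j) :
    (G.neighborFinset (o i) ∩ G.neighborFinset (o j)).card = κb := by
  rw [← hG.bridge_regular i j hij]
  congr 1
  ext b
  simp only [Finset.mem_inter, SimpleGraph.mem_neighborFinset, Finset.mem_filter]
  constructor
  · rintro ⟨h1, h2⟩
    exact ⟨(hG.mem_bridges_of_adj (Fin.lt_def.mpr (by omega)) h1.symm h2.symm).2, h1.symm, h2.symm⟩
  · rintro ⟨-, h1, h2⟩
    exact ⟨h1.symm, h2.symm⟩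

/-- For every `k` there are two peers whose orchestration neighbours are exactly `o k` and its
predecessor, if it has one. -/
lemma IsGTL.exists_pair (hG : IsGTL G o (2 * κb) κb) (hκb : 2 ≤ κb) (k : Fin n) :
    ∃ a : Fin 2 ↪ V, ∀ t i, G.Adj (a t) (o i) ↔ i = k ∨ (i : ℕ) + 1 = k := by
  set S := G.neighborFinset (o k) with hS
  suffices h : 1 < (S.filter fun b => ∀ i, G.Adj b (o i) ↔ i = k ∨ (i : ℕ) + 1 = k).card by
    obtain ⟨b, hb, c, hc, hbc⟩ := Finset.one_lt_card.mp h
    refine ⟨⟨![b, c], ?_⟩, ?_⟩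
    · intro s t hst
      fin_cases s <;> fin_cases t <;> simp_all [hbc.symm]
    · intro t
      fin_cases t
      · exact (Finset.mem_filter.mp hb).2
      · exact (Finset.mem_filter.mp hc).2
  by_cases hk : (k : ℕ) = 0
  · -- the neighbours of the first orchestration vertex, except the bridges to the second one
    have hsplit := Finset.card_filter_add_card_filter_not (s := S)
      (fun b => ∀ i, G.Adj b (o i) ↔ i = k ∨ (i : ℕ) + 1 = k)
    have hle : (S.filter fun b => ¬ ∀ i, G.Adj b (o i) ↔ i = k ∨ (i : ℕ) + 1 = k).card ≤ κb := by
      by_cases hn : 1 < n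
      · rw [← hG.card_common (i := k) (j := ⟨1, hn⟩) (by simp [hk])]
        apply Finset.card_le_card
        intro b hb
        obtain ⟨hb, hb'⟩ := Finset.mem_filter.mp hb
        rw [hS, SimpleGraph.mem_neighborFinset] at hb
        rw [Finset.mem_inter, SimpleGraph.mem_neighborFinset, SimpleGraph.mem_neighborFinset]
        refine ⟨hb, ?_⟩
        push Not at hb'
        obtain ⟨i, hi⟩ := hb'
        rcases hi with ⟨hi, hik, -⟩ | ⟨hi, rfl | hik⟩
        · have := (hG.mem_bridges_of_adj (i := k) (j := i)
            (Fin.lt_def.mpr (by have := Fin.val_ne_of_ne hik; omega)) hb.symm hi).1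
          have : i = ⟨1, hn⟩ := Fin.ext (by simp only; omega)
          exact this ▸ hi.symm
        · exact absurd hb.symm hi
        · omega
      · rw [Finset.card_eq_zero.mpr]
        · omega
        rw [Finset.filter_eq_empty_iff]
        intro b hb
        rw [hS, SimpleGraph.mem_neighborFinset] at hb
        rw [not_not]
        intro i
        have : i = k := Fin.ext (by omega)
        simp [this, hb.symm]
    rw [hS, hG.card_neighborFinset] at hsplit
    rw [← hS] at hsplit
    omega
  · have hj : (k : ℕ) - 1 < n := by omega
    have hc := hG.card_common (i := ⟨k - 1, hj⟩) (j := k) (by simp only; omega)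
    refine lt_of_lt_of_le (by omega : 1 < κb) (hc ▸ Finset.card_le_card ?_)
    intro b hb
    rw [Finset.mem_inter, SimpleGraph.mem_neighborFinset, SimpleGraph.mem_neighborFinset] at hb
    obtain ⟨h1, h2⟩ := hb
    rw [Finset.mem_filter, hS, SimpleGraph.mem_neighborFinset]
    refine ⟨h2, fun i => ⟨fun hi => ?_, ?_⟩⟩
    · -- `b` is adjacent to at most two consecutive orchestration vertices
      rcases lt_trichotomy i k with h | h | h
      · exact Or.inr (hG.mem_bridges_of_adj h hi h2.symm).1
      · exact Or.inl h
      · have := (hG.mem_bridges_of_adj (i := ⟨k - 1, hj⟩) (j := i)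
          (Fin.lt_def.mpr (by simp only; omega)) h1.symm hi).1
        simp only at this
        omega
    · rintro (rfl | h)
      · exact h2.symm
      · have : i = ⟨k - 1, hj⟩ := Fin.ext (by simp only; omega)
        exact this ▸ h1.symm

lemma IsGTL.exists_pairs (hG : IsGTL G o (2 * κb) κb) (hκb : 2 ≤ κb) :
    ∃ e : Fin n × Fin 2 ↪ V, ∀ k t i, G.Adj (e (k, t)) (o i) ↔ i = k ∨ (i : ℕ) + 1 = k := by
  choose a ha using hG.exists_pair hκb
  refine ⟨⟨fun p => a p.1 p.2, ?_⟩, ha⟩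
  rintro ⟨k, t⟩ ⟨k', t'⟩ h
  simp only at h
  have h1 := (ha k t k).mpr (Or.inl rfl)
  have h2 := (ha k' t' k').mpr (Or.inl rfl)
  rw [h, ha k' t' k] at h1
  rw [← h, ha k t k'] at h2
  have : k = k' := Fin.ext (by omega)
  subst this
  rw [(a k).injective h]

/-- The first `m + 1` orchestration vertices have `(m + 2) * κb` neighbours in total: every vertex
after the first one brings in `2 * κb` neighbours, `κb` of which are shared with the previous
vertex, and none with an earlier one. -/
lemma IsGTL.card_neighbors_lt (hG : IsGTL G o (2 * κb) κb) (m : ℕ) (hm : m < n) :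
    (Finset.univ.filter fun b => ∃ i : Fin n, (i : ℕ) < m + 1 ∧ G.Adj b (o i)).card =
      (m + 2) * κb := by
  induction m with
  | zero =>
    rw [Nat.zero_add, ← hG.card_neighborFinset ⟨0, hm⟩]
    congr 1
    ext b
    simp only [Finset.mem_filter, Finset.mem_univ, true_and, SimpleGraph.mem_neighborFinset,
      G.adj_comm (o _) b]
    constructor
    · rintro ⟨i, hi, h⟩
      have : i = ⟨0, hm⟩ := Fin.ext (by simp only; omega)
      exact this ▸ h
    · exact fun h => ⟨_, by simp, h⟩
  | succ m ih =>
    have ih := ih (by omega)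
    set W := Finset.univ.filter fun b => ∃ i : Fin n, (i : ℕ) < m + 1 ∧ G.Adj b (o i) with hW
    have hunion : (Finset.univ.filter fun b => ∃ i : Fin n, (i : ℕ) < m + 1 + 1 ∧ G.Adj b (o i)) =
        W ∪ G.neighborFinset (o ⟨m + 1, hm⟩) := by
      ext b
      simp only [hW, Finset.mem_filter, Finset.mem_univ, true_and, Finset.mem_union,
        SimpleGraph.mem_neighborFinset, G.adj_comm (o _) b]
      constructor
      · rintro ⟨i, hi, h⟩
        rcases Nat.lt_succ_iff_lt_or_eq.mp hi with h' | h'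
        · exact Or.inl ⟨i, h', h⟩
        · have : i = ⟨m + 1, hm⟩ := Fin.ext h'
          exact Or.inr (this ▸ h)
      · rintro (⟨i, hi, h⟩ | h)
        · exact ⟨i, by omega, h⟩
        · exact ⟨_, by simp, h⟩
    have hinter : W ∩ G.neighborFinset (o ⟨m + 1, hm⟩) =
        G.neighborFinset (o ⟨m, by omega⟩) ∩ G.neighborFinset (o ⟨m + 1, hm⟩) := by
      ext b
      simp only [hW, Finset.mem_filter, Finset.mem_univ, true_and, Finset.mem_inter,
        SimpleGraph.mem_neighborFinset, G.adj_comm (o _) b, and_congr_left_iff]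
      intro hb
      constructor
      · rintro ⟨i, hi, h⟩
        have h1 := (hG.mem_bridges_of_adj (i := i) (j := ⟨m + 1, hm⟩) (Fin.lt_def.mpr hi) h hb).1
        have : i = ⟨m, by omega⟩ := Fin.ext (by simp only at h1 ⊢; omega)
        exact this ▸ h
      · exact fun h => ⟨_, by simp, h⟩
    have hsum := Finset.card_union_add_card_inter W (G.neighborFinset (o ⟨m + 1, hm⟩))
    rw [hinter, hG.card_common (by simp), ih, hG.card_neighborFinset] at hsum
    rw [hunion]
    have : (m + 1 + 2) * κb = (m + 2) * κb + κb := by ring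
    omega

/-- The neighbours of the orchestration vertices outside the pairs are `κb + n * (κb - 2)` in
number. -/
lemma IsGTL.exists_rest (hG : IsGTL G o (2 * κb) κb) (hn : 1 ≤ n) (hκb : 2 ≤ κb)
    (e : Fin n × Fin 2 ↪ V)
    (he : ∀ k t i, G.Adj (e (k, t)) (o i) ↔ i = k ∨ (i : ℕ) + 1 = k) :
    ∃ z : Fin (κb + n * (κb - 2)) ↪ V,
      Set.range z = {b | (∃ i, G.Adj b (o i)) ∧ b ∉ Set.range e} := by
  set W := Finset.univ.filter fun b => ∃ i : Fin n, (i : ℕ) < n - 1 + 1 ∧ G.Adj b (o i) with hW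
  have hWcard := hG.card_neighbors_lt (n - 1) (by omega)
  rw [← hW] at hWcard
  have hsub : Finset.univ.map e ⊆ W := by
    intro b hb
    obtain ⟨⟨k, t⟩, -, rfl⟩ := Finset.mem_map.mp hb
    rw [hW, Finset.mem_filter]
    exact ⟨Finset.mem_univ _, k, by omega, (he k t k).mpr (Or.inl rfl)⟩
  have hcard : (W \ Finset.univ.map e).card = κb + n * (κb - 2) := by
    rw [Finset.card_sdiff_of_subset hsub, hWcard]
    obtain ⟨m, rfl⟩ : ∃ m, n = m + 1 := ⟨n - 1, by omega⟩
    obtain ⟨c, rfl⟩ : ∃ c, κb = c + 2 := ⟨κb - 2, by omega⟩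
    simp only [Finset.card_map, Finset.card_univ, Fintype.card_prod, Fintype.card_fin,
      Nat.add_sub_cancel]
    apply Nat.sub_eq_of_eq_add
    ring
  refine ⟨(Finset.equivFinOfCardEq hcard).symm.toEmbedding.trans (Function.Embedding.subtype _), ?_⟩
  ext b
  have hmem : b ∈ W \ Finset.univ.map e ↔ (∃ i, G.Adj b (o i)) ∧ b ∉ Set.range e := by
    simp only [hW, Finset.mem_sdiff, Finset.mem_filter, Finset.mem_univ, true_and,
      Finset.mem_map, Set.mem_range]
    refine and_congr_left fun _ => exists_congr fun i => ?_
    have : (i : ℕ) < n - 1 + 1 := by omega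
    simp [this]
  rw [Set.mem_ofPred_eq, ← hmem]
  constructor
  · rintro ⟨j, rfl⟩
    exact ((Finset.equivFinOfCardEq hcard).symm j).2
  · intro hb
    exact ⟨Finset.equivFinOfCardEq hcard ⟨b, hb⟩, by simp⟩

end Graph

/-! ### The graph state and its measurement -/

lemma czPhase_mk {V : Type*} (x : V → Fin 2) (a b : V) :
    czPhase x s(a, b) = if x a = 1 then bitSign (x b) else 1 := by
  have : czPhase x s(a, b) = if x a = 1 ∧ x b = 1 then -1 else 1 := rfl
  rw [this]
  generalize x a = p
  generalize x b = q
  fin_cases p <;> fin_cases q <;> simp [bitSign]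

section Measurement

variable {V : Type*} [Fintype V] {G : SimpleGraph V} [DecidableRel G.Adj]
  {n : ℕ} {o : Fin n ↪ V} {κc κb : ℕ}

/-- The sum modulo two of the bits of `x` at the neighbours of `v`. -/
def parity (G : SimpleGraph V) [DecidableRel G.Adj] (v : V) (x : V → Fin 2) : Fin 2 :=
  ∑ b ∈ G.neighborFinset v, x b

lemma parity_add (v : V) (x y : V → Fin 2) : parity G v (x + y) = parity G v x + parity G v y :=
  Finset.sum_add_distrib

/-- The parity constraints in terms of the parities `D` of the pairs: the `i`-th constraint contains
the `i`-th and the following pair. -/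
def pairParity (n : ℕ) : (Fin n → Fin 2) →+ (Fin n → Fin 2) where
  toFun D i := ∑ k : Fin n, if i = k ∨ (i : ℕ) + 1 = k then D k else 0
  map_zero' := by ext; simp
  map_add' D E := by
    ext i : 1
    rw [Pi.add_apply, ← Finset.sum_add_distrib]
    refine Finset.sum_congr rfl fun k _ => ?_
    split_ifs <;> simp

lemma pairParity_apply (D : Fin n → Fin 2) (i : Fin n) :
    pairParity n D i = ∑ k : Fin n, if i = k ∨ (i : ℕ) + 1 = k then D k else 0 := rfl

/-- The system of parity constraints is triangular. -/
lemma pairParity_injective (n : ℕ) : Function.Injective (pairParity n) := by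
  rw [injective_iff_map_eq_zero]
  intro D hD
  by_contra hne
  obtain ⟨j, hj⟩ := Function.ne_iff.mp hne
  -- the constraint at the last odd pair contains no other odd pair
  obtain ⟨k, hk, hmax⟩ := (Finset.univ.filter fun k => D k ≠ 0).exists_max_image id
    ⟨j, by simpa using hj⟩
  rw [Finset.mem_filter] at hk
  apply hk.2
  have h := congrFun hD k
  rw [pairParity_apply, Finset.sum_eq_single k] at h
  · simpa using h
  · intro l _ hl
    rw [ite_eq_right_iff]
    rintro (rfl | h')
    · exact absurd rfl hl
    · by_contra hl0
      have h2 := hmax l (by simpa using hl0)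
      simp only [id, Fin.le_def] at h2
      omega
  · simp

lemma pairParity_surjective (n : ℕ) : Function.Surjective (pairParity n) :=
  Finite.injective_iff_surjective.mp (pairParity_injective n)

/-- For a configuration that vanishes on the peers measured, the parity constraints only involve the
parities of the pairs. -/
lemma parity_eq_pairParity {m : ℕ} {e : Fin n × Fin 2 ↪ V} {z : Fin m ↪ V}
    (he : ∀ k t i, G.Adj (e (k, t)) (o i) ↔ i = k ∨ (i : ℕ) + 1 = k)
    (hz : Set.range z = {b | (∃ i, G.Adj b (o i)) ∧ b ∉ Set.range e}) (w : V → Fin 2)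
    (hw : ∀ j, w (z j) = 0) (i : Fin n) :
    parity G (o i) w = pairParity n (fun k => w (e (k, 0)) + w (e (k, 1))) i := by
  have h1 : parity G (o i) w = ∑ b, if G.Adj b (o i) then w b else 0 := by
    rw [← Finset.sum_filter, parity]
    refine Finset.sum_congr ?_ fun _ _ => rfl
    ext b
    simp [G.adj_comm b]
  rw [h1, ← Finset.sum_subset (Finset.subset_univ (Finset.univ.map e))]
  · rw [Finset.sum_map, Fintype.sum_prod_type, pairParity_apply]
    refine Finset.sum_congr rfl fun k _ => ?_
    simp only [he, Fin.sum_univ_two]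
    split_ifs <;> simp
  · intro b _ hb
    rw [ite_eq_right_iff]
    intro hadj
    have : b ∈ Set.range z := by
      rw [hz]
      exact ⟨⟨i, hadj⟩, by simpa using hb⟩
    obtain ⟨j, rfl⟩ := this
    exact hw j

variable [DecidableEq V]

lemma IsGTL.parity_add_single (hG : IsGTL G o κc κb) (i j : Fin n) (x : V → Fin 2) :
    parity G (o i) (x + Pi.single (o j) 1) = parity G (o i) x := by
  rw [parity_add, add_eq_left, parity]
  refine Finset.sum_eq_zero fun b hb => ?_
  rw [SimpleGraph.mem_neighborFinset] at hb
  refine Pi.single_eq_of_ne ?_ _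
  rintro rfl
  exact hG.orch_indep _ (mem_orch.mpr ⟨i, rfl⟩) _ (mem_orch.mpr ⟨j, rfl⟩) hb

/-- Every edge joins an orchestration vertex to a peer, so that the controlled-`Z` gates can be
grouped by their orchestration vertices. -/
lemma IsGTL.graphState_eq (hG : IsGTL G o κc κb) (x : V → Fin 2) :
    graphState G x = (∏ _v : V, ((1 / Real.sqrt 2 : ℝ) : ℂ)) *
      ∏ i, if x (o i) = 1 then bitSign (parity G (o i) x) else 1 := by
  rw [graphState, mul_comm]
  congr 1
  have h1 : ∀ i, (if x (o i) = 1 then bitSign (parity G (o i) x) else 1) =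
      ∏ b ∈ G.neighborFinset (o i), czPhase x s(o i, b) := by
    intro i
    simp only [czPhase_mk]
    split_ifs
    · rw [parity, bitSign_sum]
    · simp
  simp only [h1]
  rw [Finset.prod_sigma']
  symm
  refine Finset.prod_bij (fun p _ => s(o p.1, p.2)) ?_ ?_ ?_ (fun _ _ => rfl)
  · rintro ⟨i, b⟩ h
    simpa using h
  · rintro ⟨i, b⟩ h ⟨j, c⟩ h' heq
    simp only [Finset.mem_sigma, Finset.mem_univ, true_and, SimpleGraph.mem_neighborFinset] at h h'
    rw [Sym2.eq_iff] at heq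
    rcases heq with ⟨h1, rfl⟩ | ⟨-, rfl⟩
    · obtain rfl := o.injective h1
      rfl
    · exact absurd h (hG.orch_indep _ (mem_orch.mpr ⟨i, rfl⟩) _ (mem_orch.mpr ⟨j, rfl⟩))
  · intro ε hε
    induction ε with
    | _ a b =>
      have hab : G.Adj a b := by simpa using hε
      by_cases ha : a ∈ peers o
      · have hb : b ∉ peers o := fun hb => hG.peers_indep a ha b hb hab
        simp only [mem_peers, not_forall, not_not] at hb
        obtain ⟨i, rfl⟩ := hb
        exact ⟨⟨i, a⟩, by simpa using hab.symm, Sym2.eq_swap⟩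
      · simp only [mem_peers, not_forall, not_not] at ha
        obtain ⟨i, rfl⟩ := ha
        exact ⟨⟨i, b⟩, by simpa using hab, rfl⟩

lemma prod_sqrt_ne_zero (V : Type*) [Fintype V] : (∏ _v : V, ((1 / Real.sqrt 2 : ℝ) : ℂ)) ≠ 0 := by
  refine Finset.prod_ne_zero_iff.mpr fun _ _ => ?_
  rw [Complex.ofReal_ne_zero]
  positivity

lemma IsGTL.graphState_ne_zero (hG : IsGTL G o κc κb) (x : V → Fin 2) : graphState G x ≠ 0 := by
  rw [hG.graphState_eq]
  refine mul_ne_zero (prod_sqrt_ne_zero V) (Finset.prod_ne_zero_iff.mpr fun i _ => ?_)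
  split_ifs
  · exact bitSign_ne_zero _
  · exact one_ne_zero

/-- The stabiliser of the graph state at an orchestration vertex. -/
lemma IsGTL.graphState_add_single (hG : IsGTL G o κc κb) (i : Fin n) (x : V → Fin 2) :
    graphState G (x + Pi.single (o i) 1) = bitSign (parity G (o i) x) * graphState G x := by
  rw [hG.graphState_eq, hG.graphState_eq, mul_left_comm]
  congr 1
  rw [← Finset.mul_prod_erase _ _ (Finset.mem_univ i),
    ← Finset.mul_prod_erase (a := i) _ _ (Finset.mem_univ i), ← mul_assoc]
  congr 1
  · rw [hG.parity_add_single, Pi.add_apply, Pi.single_eq_same]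
    generalize x (o i) = a
    generalize parity G (o i) x = b
    fin_cases a <;> fin_cases b <;> simp [bitSign]
  · refine Finset.prod_congr rfl fun j hj => ?_
    rw [hG.parity_add_single, Pi.add_apply, Pi.single_eq_of_ne, add_zero]
    exact o.injective.ne (Finset.ne_of_mem_erase hj)

/-- The measured state is the restriction of the graph state to the configurations that satisfy the
parity constraints at the orchestration vertices and agree with the outcomes at the peers
measured. -/
lemma IsGTL.measured_eq (hG : IsGTL G o κc κb) {m : ℕ} (z : Fin m → V) (s : Fin n → Fin 2)
    (t : Fin m → Fin 2) :
    measurePauli pauliZ (List.ofFn fun j => (z j, t j))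
        (measurePauli pauliX (List.ofFn fun i => (o i, s i)) (graphState G)) =
      fun x => if (∀ j, x (z j) = t j) ∧ ∀ i, parity G (o i) x = s i then graphState G x else 0 := by
  rw [measurePauli_pauliX _ _ (parity G), measurePauli_pauliZ]
  · ext x
    simp only [List.forall_mem_ofFn_iff]
    split_ifs <;> tauto
  · rw [List.forall_mem_ofFn_iff]
    exact hG.graphState_add_single
  · rw [List.forall_mem_ofFn_iff]
    intro i
    rw [List.forall_mem_ofFn_iff]
    exact fun j => hG.parity_add_single i j

/-- The correction `c` makes the parity constraints, given the outcomes, equivalent to the equality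
of the two bits of every pair. -/
lemma IsGTL.exists_correction (hG : IsGTL G o κc κb) {m : ℕ} {e : Fin n × Fin 2 ↪ V}
    {z : Fin m ↪ V} (he : ∀ k t i, G.Adj (e (k, t)) (o i) ↔ i = k ∨ (i : ℕ) + 1 = k)
    (hz : Set.range z = {b | (∃ i, G.Adj b (o i)) ∧ b ∉ Set.range e}) (s : Fin n → Fin 2)
    (t : Fin m → Fin 2) {φ : QState V}
    (hφ : φ = measurePauli pauliZ (List.ofFn fun j => (z j, t j))
        (measurePauli pauliX (List.ofFn fun i => (o i, s i)) (graphState G))) :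
    φ ≠ 0 ∧ ∃ c : V → Fin 2, BellPairsOn e fun x => φ (x + c) := by
  rw [hG.measured_eq] at hφ
  have hze : ∀ j, z j ∉ Set.range e := by
    intro j
    have : z j ∈ Set.range z := ⟨j, rfl⟩
    rw [hz] at this
    exact this.2
  have hez : ∀ p, ¬ ∃ j, z j = e p := fun p ⟨j, hj⟩ => hze j ⟨p, hj.symm⟩
  have hoe : ∀ i, o i ∉ Set.range e := by
    rintro i ⟨⟨k, r⟩, h⟩
    have h1 := (he k r k).mpr (Or.inl rfl)
    rw [h] at h1
    exact hG.orch_indep _ (mem_orch.mpr ⟨i, rfl⟩) _ (mem_orch.mpr ⟨k, rfl⟩) h1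
  set xt : V → Fin 2 := Function.extend z t 0 with hxt
  have xt_z : ∀ j, xt (z j) = t j := fun j => z.injective.extend_apply _ _ _
  have xt_e : ∀ p, xt (e p) = 0 := fun p => Function.extend_apply' _ _ _ (hez p)
  obtain ⟨d, hd⟩ := pairParity_surjective n fun i => s i + parity G (o i) xt
  set c : V → Fin 2 := Function.extend e (fun p => if p.2 = 0 then d p.1 else 0) 0 with hc
  have c_fst : ∀ k, c (e (k, 0)) = d k := fun k => by simp [hc, e.injective.extend_apply]
  have c_snd : ∀ k, c (e (k, 1)) = 0 := fun k => by simp [hc, e.injective.extend_apply]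
  have c_off : ∀ v, v ∉ Set.range e → c v = 0 := fun v hv => Function.extend_apply' _ _ _ hv
  have hbase : ∀ i, parity G (o i) (xt + c) = s i := by
    intro i
    rw [parity_add, parity_eq_pairParity he hz c fun j => c_off _ (hze j)]
    simp only [c_fst, c_snd, add_zero]
    rw [hd, add_left_comm, bit_add_self, add_zero]
  refine ⟨?_, c, ?_⟩
  · intro h0
    have h1 := congrFun h0 (xt + c)
    rw [hφ] at h1
    simp only at h1
    rw [if_pos ⟨fun j => by rw [Pi.add_apply, xt_z, c_off _ (hze j), add_zero], hbase⟩] at h1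
    exact hG.graphState_ne_zero _ h1
  have hsqrt : ((1 / Real.sqrt 2 : ℝ) : ℂ) ≠ 0 := by
    rw [Complex.ofReal_ne_zero]
    positivity
  refine ⟨fun y => if ∀ j, y ⟨z j, hze j⟩ = t j then
    (((1 / Real.sqrt 2 : ℝ) : ℂ) ^ n)⁻¹ * ((∏ _v : V, ((1 / Real.sqrt 2 : ℝ) : ℂ)) *
      ∏ i, if y ⟨o i, hoe i⟩ = 1 then bitSign (s i) else 1) else 0, fun x => ?_⟩
  have hxz : ∀ j, (x + c) (z j) = x (z j) := fun j => by
    rw [Pi.add_apply, c_off _ (hze j), add_zero]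
  rw [hφ]
  simp only [hxz]
  by_cases hx : ∀ j, x (z j) = t j
  · have hpar : (∀ i, parity G (o i) (x + c) = s i) ↔
        (fun k => x (e (k, 0))) = fun k => x (e (k, 1)) := by
      have hdecomp : x + c = (xt + c) + (x + xt) := by
        ext v : 1
        simp only [Pi.add_apply]
        calc x v + c v = x v + c v + (xt v + xt v) := by rw [bit_add_self, add_zero]
          _ = xt v + c v + (x v + xt v) := by abel
      have hw : ∀ j, (x + xt) (z j) = 0 := fun j => by
        rw [Pi.add_apply, hx, xt_z, bit_add_self]
      have h1 : ∀ i, parity G (o i) (x + c) =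
          s i + pairParity n (fun k => x (e (k, 0)) + x (e (k, 1))) i := by
        intro i
        rw [hdecomp, parity_add, hbase, parity_eq_pairParity he hz _ hw]
        simp only [Pi.add_apply, xt_e, add_zero]
      simp only [h1, add_eq_left]
      rw [← funext_iff (g := fun _ => 0)]
      change pairParity n _ = 0 ↔ _
      rw [map_eq_zero_iff _ (pairParity_injective n), funext_iff, funext_iff]
      simp only [Pi.zero_apply, bit_add_eq_zero]
    rw [prod_bellAmp (fun k => x (e (k, 0))) fun k => x (e (k, 1)), if_pos hx]
    by_cases hp : (fun k => x (e (k, 0))) = fun k => x (e (k, 1))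
    · have hs := hpar.mpr hp
      rw [if_pos ⟨hx, hs⟩, if_pos hp, mul_inv_cancel_left₀ (pow_ne_zero _ hsqrt),
        hG.graphState_eq]
      simp only [hs, Pi.add_apply, c_off _ (hoe _), add_zero]
    · rw [if_neg fun h => hp (hpar.mp h.2), if_neg hp, zero_mul]
  · rw [if_neg fun h => hx h.1, if_neg hx, mul_zero]

/-- Expanding the controlled-`Z` gates over the bits of the orchestration qubits writes the graph
state as a sum of `2 ^ n` product vectors. -/
lemma IsGTL.hasProductRank (hG : IsGTL G o κc κb) : HasProductRank (graphState G) (2 ^ n) := by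
  have hcard : Fintype.card (Fin n → Fin 2) = 2 ^ n := by simp
  rw [← hcard]
  refine HasProductRank.of_sum (∏ _v : V, ((1 / Real.sqrt 2 : ℝ) : ℂ))
    (fun (y : Fin n → Fin 2) x => ∏ i, ∏ u ∈ insert (o i) (G.neighborFinset (o i)),
      if u = o i then (if x u = y i then 1 else 0) else if y i = 1 then bitSign (x u) else 1)
    (fun y => ?_) fun x => ?_
  · refine IsProductVector.prod _ _ fun i _ => IsProductVector.prod _ _ fun u _ => ?_
    exact IsProductVector.single u fun a =>
      if u = o i then (if a = y i then 1 else 0) else if y i = 1 then bitSign a else 1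
  · rw [hG.graphState_eq, ← Finset.mul_sum]
    congr 1
    rw [← Fintype.prod_sum fun i a => ∏ u ∈ insert (o i) (G.neighborFinset (o i)),
      if u = o i then (if x u = a then 1 else 0) else if a = 1 then bitSign (x u) else 1]
    refine Finset.prod_congr rfl fun i _ => ?_
    have h1 : ∀ a : Fin 2, (∏ u ∈ insert (o i) (G.neighborFinset (o i)),
        if u = o i then (if x u = a then (1 : ℂ) else 0)
          else if a = 1 then bitSign (x u) else 1) =
        if x (o i) = a then (if a = 1 then bitSign (parity G (o i) x) else 1) else 0 := by
      intro a
      rw [Finset.prod_insert (by simp), if_pos rfl, ite_mul, one_mul, zero_mul]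
      congr 1
      rw [parity, bitSign_sum]
      have h2 : ∀ u ∈ G.neighborFinset (o i), (if u = o i then (if x u = a then (1 : ℂ) else 0)
          else if a = 1 then bitSign (x u) else 1) = if a = 1 then bitSign (x u) else 1 := by
        intro u hu
        rw [SimpleGraph.mem_neighborFinset] at hu
        rw [if_neg hu.ne']
      rw [Finset.prod_congr rfl h2]
      split_ifs <;> simp
    simp only [h1]
    rw [Finset.sum_ite_eq Finset.univ (x (o i)), if_pos (Finset.mem_univ _)]

/-- Measuring, and then undoing the bit flips that the outcomes dictate, is an LOCC protocol. -/
lemma IsGTL.exists_extracts (hG : IsGTL G o κc κb) {m : ℕ} {e : Fin n × Fin 2 ↪ V}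
    {z : Fin m ↪ V} (he : ∀ k t i, G.Adj (e (k, t)) (o i) ↔ i = k ∨ (i : ℕ) + 1 = k)
    (hz : Set.range z = {b | (∃ i, G.Adj b (o i)) ∧ b ∉ Set.range e}) :
    ∃ p : LOCC V, p.Extracts (graphState G) n := by
  choose c hc using fun s t => (hG.exists_correction he hz s t rfl).2
  choose q hq using fun s t => LOCC.exists_bitFlip (c s t)
  choose r hr using fun s => LOCC.exists_measurePauli pauliZ sum_pauliProj_pauliZ z (q s)
  obtain ⟨p, hp⟩ := LOCC.exists_measurePauli pauliX sum_pauliProj_pauliX o r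
  refine ⟨p, fun φ hφ _ => ⟨e, ?_⟩⟩
  obtain ⟨s, hs⟩ := hp _ φ hφ
  obtain ⟨t, ht⟩ := hr s _ φ hs
  rw [hq, Set.mem_singleton_iff] at ht
  rw [ht]
  exact hc s t

end Measurement

end GTLState

theorem mainTheorem3 {V : Type*} [Fintype V] [DecidableEq V] (G : SimpleGraph V)
    [DecidableRel G.Adj] (no κb : ℕ) (o : Fin no ↪ V) (hno : 1 ≤ no) (hκb : 2 ≤ κb)
    (hG : GTLState.IsGTL G o (2 * κb) κb) :
    -- `X` on all orchestration qubits, then `κb + no (κb - 2)` times `Z` on peers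
    (∃ (z : Fin (κb + no * (κb - 2)) ↪ V) (e : Fin no × Fin 2 ↪ V),
      (∀ j, z j ∈ GTLState.peers o) ∧
      (∀ p, e p ∈ GTLState.peers o ∧ e p ∉ Set.range z) ∧
      ∀ (s : Fin no → Fin 2) (t : Fin (κb + no * (κb - 2)) → Fin 2),
        ∃ φ : GTLState.QState V,
          φ = GTLState.measurePauli GTLState.pauliZ (List.ofFn fun j => (z j, t j))
            (GTLState.measurePauli GTLState.pauliX (List.ofFn fun i => (o i, s i))
              (GTLState.graphState G)) ∧
          φ ≠ 0 ∧
          ∃ U : V → GTLState.QubitOp, (∀ v, U v ∈ Matrix.unitaryGroup (Fin 2) ℂ) ∧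
            GTLState.BellPairsOn e (GTLState.applyProd U φ)) ∧
    -- the Schmidt measure
    GTLState.schmidtMeasure (GTLState.graphState G) = no ∧
    -- no branch of an LOCC protocol holds more than `no` disjoint Bell pairs
    (∀ (p : GTLState.LOCC V) (k : ℕ) (e : Fin k × Fin 2 ↪ V),
      ∀ φ ∈ p.branches (GTLState.graphState G), φ ≠ 0 → GTLState.BellPairsOn e φ → k ≤ no) ∧
    -- `no` is the maximum
    IsGreatest {k : ℕ | ∃ p : GTLState.LOCC V, p.Extracts (GTLState.graphState G) k} no := by
  obtain ⟨e, he⟩ := hG.exists_pairs hκb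
  obtain ⟨z, hz⟩ := hG.exists_rest hno hκb e he
  have hrank := hG.hasProductRank
  have hbound : ∀ (p : GTLState.LOCC V) (k : ℕ) (e : Fin k × Fin 2 ↪ V),
      ∀ φ ∈ p.branches (GTLState.graphState G), φ ≠ 0 → GTLState.BellPairsOn e φ → k ≤ no := by
    intro p k e φ hφ h0 hB
    exact (Nat.pow_le_pow_iff_right (by norm_num)).mp
      ((hrank.of_mem_branches p hφ).two_pow_le e hB h0)
  have hne : GTLState.graphState G ≠ 0 := fun h => hG.graphState_ne_zero 0 (congrFun h 0)
  obtain ⟨p, hp⟩ := hG.exists_extracts he hz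
  refine ⟨⟨z, e, fun j => ?_, ?_, fun s t => ?_⟩, ?_, hbound, ⟨p, hp⟩, ?_⟩
  · have : z j ∈ Set.range z := ⟨j, rfl⟩
    rw [hz] at this
    obtain ⟨⟨i, hi⟩, -⟩ := this
    exact hG.mem_peers_of_adj hi
  · rintro ⟨k, t⟩
    refine ⟨hG.mem_peers_of_adj ((he k t k).mpr (Or.inl rfl)), fun h => ?_⟩
    rw [hz] at h
    exact h.2 ⟨_, rfl⟩
  · obtain ⟨h0, c, hc⟩ := hG.exists_correction he hz s t rfl
    refine ⟨_, rfl, h0, fun v => GTLState.bitFlip (c v),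
      fun v => GTLState.bitFlip_mem_unitaryGroup _, ?_⟩
    rw [GTLState.applyProd_bitFlip]
    exact hc
  · -- the lower bound on the rank comes from the `no` Bell pairs that the protocol extracts
    have hmin : GTLState.schmidtRank (GTLState.graphState G) = 2 ^ no := by
      refine le_antisymm (Nat.sInf_le hrank) (le_csInf ⟨_, hrank⟩ fun r hr => ?_)
      obtain ⟨φ, hφ, h0⟩ := p.exists_branch_ne_zero hne
      obtain ⟨e', hB⟩ := hp φ hφ h0
      exact (GTLState.HasProductRank.of_mem_branches p hr hφ).two_pow_le e' hB h0
    rw [GTLState.schmidtMeasure, hmin]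
    push_cast
    rw [Real.logb_pow, Real.logb_self_eq_one (by norm_num), mul_one]
  · rintro k ⟨q, hq⟩
    obtain ⟨φ, hφ, h0⟩ := q.exists_branch_ne_zero hne
    obtain ⟨e', hB⟩ := hq φ hφ h0
    exact hbound q k e' φ hφ h0 hB
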